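/- A caterpillar is a finite tree such that removing all its leaves (vertices of degree $1$) leaves a path, called the spine. For an integer $\Delta\ge 2$, a caterpillar is $\Delta$-regular if its spine has at least one vertex and every spine vertex has degree $\Delta$ in the tree. An $h$-placement of an $n$-vertex graph $C$ is a graph $G$ on $n$ vertices (the host graph) that contains $h$ pairwise edge-disjoint spanning subgraphs, each isomorphic to $C$. A graph is $k$-planar if it has a drawing in the plane (vertices are distinct points, edges are simple curves joining their end-vertices and passing through no other vertex) in which each edge is crossed at most $k$ times. There is an absolute constant $K$ such that the following holds. Let $C$ be a $\Delta$-regular caterpillar with $n$ vertices and $\sigma$ spine vertices, and let $h\ge 0$ be an integer. An $h$-placement of $C$ exists if and only if (i) $\Delta\le n-h$, and (ii) $n\ge 2h+(\Delta-1)\cdot(\sigma \bmod 2)$. Moreover, if an $h$-placement of $C$ exists, then there exists one that is $k$-planar for some $k\le K(\Delta h+h^2)$; that is, $k\in O(\Delta h+h^2)$. -/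

import Mathlib

/-- The spine vertices of a graph: the vertices that remain when all leaves
(vertices of degree one) are removed. -/
def spine {V : Type*} [Fintype V] (C : SimpleGraph V) [DecidableRel C.Adj] : Finset V :=
  Finset.univ.filter fun v => C.degree v ≠ 1

/-- A caterpillar: a tree such that removing all leaves leaves a path. -/
structure IsCaterpillar {V : Type*} [Fintype V] (C : SimpleGraph V) [DecidableRel C.Adj] :
    Prop where
  isTree : C.IsTree
  spine_path : Nonempty (C.induce (spine C : Set V) ≃g SimpleGraph.pathGraph (spine C).card)

/-- A `Δ`-regular caterpillar, `Δ ≥ 2`: a caterpillar with at least one spine vertex, all of whose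
spine vertices have degree `Δ`. -/
structure IsRegularCaterpillar {V : Type*} [Fintype V] (C : SimpleGraph V) [DecidableRel C.Adj]
    (Δ : ℕ) : Prop extends IsCaterpillar C where
  two_le : 2 ≤ Δ
  spine_nonempty : (spine C).Nonempty
  degree_eq : ∀ v ∈ spine C, C.degree v = Δ

/-- `G` is (the host graph of) an `h`-placement of `C`: it contains `h` pairwise edge-disjoint
spanning subgraphs, each isomorphic to `C`. -/
def IsPlacement {V : Type*} (C : SimpleGraph V) (h : ℕ) (G : SimpleGraph V) : Prop :=
  ∃ T : Fin h → SimpleGraph V,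
    (∀ i, T i ≤ G) ∧ (∀ i, Nonempty (C ≃g T i)) ∧
      ∀ i j, i ≠ j → Disjoint (T i).edgeSet (T j).edgeSet

/-- A drawing of a graph in the plane: vertices are distinct points, edges are simple curves
joining their end-vertices and passing through no vertex in between. -/
structure PlaneDrawing {V : Type*} (G : SimpleGraph V) where
  point : V → ℝ × ℝ
  point_injective : Function.Injective point
  curve : G.edgeSet → unitInterval → ℝ × ℝ
  curve_continuous : ∀ e, Continuous (curve e)
  curve_injective : ∀ e, Function.Injective (curve e)
  curve_ends : ∀ e, s(curve e 0, curve e 1) = Sym2.map point (e : Sym2 V)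
  curve_avoids : ∀ e, ∀ t ∈ Set.Ioo (0 : unitInterval) 1, ∀ v, curve e t ≠ point v

/-- The relative interior of the curve representing the edge `e`. -/
def PlaneDrawing.inner {V : Type*} {G : SimpleGraph V} (D : PlaneDrawing G) (e : G.edgeSet) :
    Set (ℝ × ℝ) :=
  D.curve e '' Set.Ioo (0 : unitInterval) 1

/-- The crossings on the edge `e`: all pairs of another edge `f` and a common interior point of the
curves of `e` and `f`. If several edges pass through the same point of `e`, each of them counts. -/
def PlaneDrawing.crossings {V : Type*} {G : SimpleGraph V} (D : PlaneDrawing G) (e : G.edgeSet) :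
    Set (G.edgeSet × (ℝ × ℝ)) :=
  {c | c.1 ≠ e ∧ c.2 ∈ D.inner e ∧ c.2 ∈ D.inner c.1}

/-- A `k`-planar graph: it has a drawing in the plane in which every edge is crossed at most
`k` times. -/
def IsKPlanar {V : Type*} (G : SimpleGraph V) (k : ℕ) : Prop :=
  ∃ D : PlaneDrawing G, ∀ e, (D.crossings e).encard ≤ k

/-! Put `D = Δ - 1`. Counting degrees gives `n = σ * D + 2`, and then (i) and (ii) together say
exactly `h ≤ ⌊σ/2⌋ * D + 1`.

Necessity: if `v` is a spine vertex in `a v` of the copies, its degrees there sum to `h + D * a v ≤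
n - 1`, while the `a v` sum to `h * σ`. For even `σ`, averaging over `v` suffices. For odd `σ`, too
large an `h` forces `a v ≤ ⌊σ/2⌋` by integrality, and summing gives a contradiction.

Sufficiency: place the vertices in convex position and draw the caterpillar as a zigzag. Its edges
are the chords from `u` to `n - 1 - w`, with `(u, w)` running along a monotone staircase close to
the diagonal. The copies are the rotations of this zigzag by `0, …, h - 1`. Monotonicity of the
staircase makes them edge-disjoint (`RotatedChord.eq_of_same_ends`,
`RotatedChord.not_swapped_ends`). Chords can cross only if their values of `u + w` differ by at most
`2 * h + D` (`RotatedChord.sum_le_of_interleaving`), which leaves `O(h + D)` candidates in each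
copy. -/

/-! ### Straight-line drawings in convex position -/

/-- Two chords of the parabola with a common interior point, the first being `ab` with `a < b` and
the second `cd` with `c < d`, coincide or have interleaving ends. -/
theorem interleave_of_chords_meet {a b c d x : ℝ} (hax : a < x) (hxb : x < b) (hcx : c < x)
    (hxd : x < d) (h : (a + b) * x - a * b = (c + d) * x - c * d) :
    (a = c ∧ b = d) ∨ (a < c ∧ c < b ∧ b < d) ∨ (c < a ∧ a < d ∧ d < b) := by
  -- Both sides are the height of the common point above the parabola.
  have key : (x - a) * (b - x) = (x - c) * (d - x) := by linarith
  rcases lt_trichotomy a c with h1 | h1 | h1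
  · refine Or.inr (Or.inl ⟨h1, by linarith, ?_⟩)
    by_contra! h2
    nlinarith [mul_pos (sub_pos.2 h1) (sub_pos.2 hxb),
      mul_nonneg (sub_nonneg.2 hcx.le) (sub_nonneg.2 h2)]
  · subst h1
    have := mul_left_cancel₀ (sub_pos.2 hax).ne' key
    exact Or.inl ⟨rfl, by linarith⟩
  · refine Or.inr (Or.inr ⟨h1, by linarith, ?_⟩)
    by_contra! h2
    nlinarith [mul_pos (sub_pos.2 h1) (sub_pos.2 hxd),
      mul_nonneg (sub_nonneg.2 hax.le) (sub_nonneg.2 h2)]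

/-- Distinct chords of the parabola meet in at most one abscissa. -/
theorem chords_meet_unique {a b c d x y : ℝ} (hab : a < b) (hcd : c < d) (hne : ¬(a = c ∧ b = d))
    (hx : (a + b) * x - a * b = (c + d) * x - c * d)
    (hy : (a + b) * y - a * b = (c + d) * y - c * d) : x = y := by
  by_contra hxy
  -- Two affine functions agreeing at two points have the same slope `a + b` and the same constant
  -- term, so `{a, b}` and `{c, d}` are the roots of one quadratic.
  have h1 : (a + b - (c + d)) * (x - y) = 0 := by linarith
  have h2 : a + b = c + d := by
    rcases mul_eq_zero.1 h1 with h | h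
    · linarith
    · exact absurd (by linarith) hxy
  have h3 : a * b = c * d := by rw [h2] at hx; linarith
  have h4 : (a - c) * (a - d) = 0 := by
    have : b = c + d - a := by linarith
    subst this
    linarith
  rcases mul_eq_zero.1 h4 with h | h
  · exact hne ⟨by linarith, by linarith⟩
  · linarith

section ParabolaDrawing

variable {V : Type*} {G : SimpleGraph V} {p : V → ℕ}

theorem exists_ordered_ends (hp : Function.Injective p) (e : G.edgeSet) :
    ∃ x : V × V, (e : Sym2 V) = s(x.1, x.2) ∧ p x.1 < p x.2 := by
  obtain ⟨e, he⟩ := e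
  induction e with
  | h x y =>
    have hne : p x ≠ p y := fun h => G.ne_of_adj (G.mem_edgeSet.1 he) (hp h)
    rcases hne.lt_or_gt with h | h
    · exact ⟨(x, y), rfl, h⟩
    · exact ⟨(y, x), Sym2.eq_swap, h⟩

/-- The point of the chord of the parabola `y = x ^ 2` between the abscissae `a` and `b`
at parameter `t`. -/
def parabolaChord (a b t : ℝ) : ℝ × ℝ :=
  (a + t * (b - a), (a + b) * (a + t * (b - a)) - a * b)

/-- The straight-line drawing with the vertices on a parabola. -/
noncomputable def parabolaDrawing (G : SimpleGraph V) (p : V → ℕ) (hp : Function.Injective p) :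
    PlaneDrawing G where
  point v := ((p v : ℝ), (p v : ℝ) ^ 2)
  point_injective v w h := hp (by simpa using congrArg Prod.fst h)
  curve e t := parabolaChord (p (exists_ordered_ends hp e).choose.1)
    (p (exists_ordered_ends hp e).choose.2) t
  curve_continuous e := by unfold parabolaChord; fun_prop
  curve_injective e t t' h := by
    have hlt := (exists_ordered_ends hp e).choose_spec.2
    have h1 := congrArg Prod.fst h
    simp only [parabolaChord, add_right_inj, mul_eq_mul_right_iff] at h1
    rcases h1 with h1 | h1
    · exact Subtype.ext h1
    · have : (p (exists_ordered_ends hp e).choose.1 : ℝ) < p (exists_ordered_ends hp e).choose.2 :=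
        by exact_mod_cast hlt
      linarith
  curve_ends e := by
    conv_rhs => rw [(exists_ordered_ends hp e).choose_spec.1]
    simp only [parabolaChord, Sym2.map_mk]
    congr 1
    exacts [Prod.ext (by simp) (by simp; ring), Prod.ext (by simp) (by simp; ring)]
  curve_avoids e t ht v h := by
    have hlt : (p (exists_ordered_ends hp e).choose.1 : ℝ) < p (exists_ordered_ends hp e).choose.2 :=
      by exact_mod_cast (exists_ordered_ends hp e).choose_spec.2
    have h1 := congrArg Prod.fst h
    have h2 := congrArg Prod.snd h
    simp only [parabolaChord] at h1 h2
    set a : ℝ := (p (exists_ordered_ends hp e).choose.1 : ℝ)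
    set b : ℝ := (p (exists_ordered_ends hp e).choose.2 : ℝ)
    rw [h1] at h2
    have h3 : ((p v : ℝ) - a) * (b - p v) = 0 := by linarith
    have t0 : (0 : ℝ) < t := ht.1
    have t1 : (t : ℝ) < 1 := ht.2
    have h4 : 0 < (t : ℝ) * (b - a) := mul_pos t0 (sub_pos.2 hlt)
    have h5 : 0 < (1 - (t : ℝ)) * (b - a) := mul_pos (sub_pos.2 t1) (sub_pos.2 hlt)
    rcases mul_eq_zero.1 h3 with h | h <;> linarith

theorem parabolaDrawing_inner {hp : Function.Injective p} {e : G.edgeSet} {c : ℝ × ℝ}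
    (hc : c ∈ (parabolaDrawing G p hp).inner e) :
    (p (exists_ordered_ends hp e).choose.1 : ℝ) < c.1 ∧
      c.1 < p (exists_ordered_ends hp e).choose.2 ∧
      c.2 = ((p (exists_ordered_ends hp e).choose.1 : ℝ) + p (exists_ordered_ends hp e).choose.2)
        * c.1 - p (exists_ordered_ends hp e).choose.1 * p (exists_ordered_ends hp e).choose.2 := by
  obtain ⟨t, ht, rfl⟩ := hc
  have hlt : (p (exists_ordered_ends hp e).choose.1 : ℝ) < p (exists_ordered_ends hp e).choose.2 :=
    by exact_mod_cast (exists_ordered_ends hp e).choose_spec.2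
  simp only [parabolaDrawing, parabolaChord]
  have t0 : (0 : ℝ) < t := ht.1
  have t1 : (t : ℝ) < 1 := ht.2
  refine ⟨?_, ?_, trivial⟩
  · nlinarith [mul_pos t0 (sub_pos.2 hlt)]
  · nlinarith [mul_pos (sub_pos.2 t1) (sub_pos.2 hlt)]

/-- If the vertices are placed in convex position in the order given by `p` and every edge is
interleaved by at most `k` others, then the graph is `k`-planar. -/
theorem isKPlanar_of_interleaving (hp : Function.Injective p) {k : ℕ}
    (H : ∀ x y, G.Adj x y → p x < p y →
      {f : Sym2 V | f ∈ G.edgeSet ∧ ∃ z w, f = s(z, w) ∧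
        ((p x < p z ∧ p z < p y ∧ p y < p w) ∨ (p z < p x ∧ p x < p w ∧ p w < p y))}.encard ≤ k) :
    IsKPlanar G k := by
  refine ⟨parabolaDrawing G p hp, fun e => ?_⟩
  obtain ⟨he, hlt⟩ := (exists_ordered_ends hp e).choose_spec
  have hadj := e.2
  rw [he, SimpleGraph.mem_edgeSet] at hadj
  refine le_trans ?_ (H _ _ hadj hlt)
  have hne : ∀ f : G.edgeSet, f ≠ e →
      ¬(p (exists_ordered_ends hp e).choose.1 = p (exists_ordered_ends hp f).choose.1 ∧
        p (exists_ordered_ends hp e).choose.2 = p (exists_ordered_ends hp f).choose.2) := by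
    rintro f hf ⟨h1, h2⟩
    apply hf
    apply Subtype.ext
    rw [he, (exists_ordered_ends hp f).choose_spec.1, hp h1, hp h2]
  -- A crossing is determined by the other edge, since distinct chords meet at most once.
  refine Set.encard_le_encard_of_injOn (f := fun c => (c.1 : Sym2 V)) ?_ ?_
  · rintro ⟨f, c⟩ ⟨hfe, hce, hcf⟩
    obtain ⟨h1, h2, h3⟩ := parabolaDrawing_inner hce
    obtain ⟨h4, h5, h6⟩ := parabolaDrawing_inner hcf
    refine ⟨f.2, _, _, (exists_ordered_ends hp f).choose_spec.1, ?_⟩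
    rcases interleave_of_chords_meet h1 h2 h4 h5 (h3.symm.trans h6) with h | h | h
    · exact absurd (by exact_mod_cast h) (hne f hfe)
    · exact Or.inl (by exact_mod_cast h)
    · exact Or.inr (by exact_mod_cast h)
  · rintro ⟨f, c⟩ ⟨hfe, hce, hcf⟩ ⟨f', c'⟩ ⟨-, hce', hcf'⟩ hff
    obtain rfl : f = f' := Subtype.ext hff
    have hf := (exists_ordered_ends hp f).choose_spec.2
    obtain ⟨-, -, h3⟩ := parabolaDrawing_inner hce
    obtain ⟨-, -, h6⟩ := parabolaDrawing_inner hcf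
    obtain ⟨-, -, h3'⟩ := parabolaDrawing_inner hce'
    obtain ⟨-, -, h6'⟩ := parabolaDrawing_inner hcf'
    have hx : c.1 = c'.1 :=
      chords_meet_unique (by exact_mod_cast hlt) (by exact_mod_cast hf)
        (by exact_mod_cast hne f hfe) (h3.symm.trans h6) (h3'.symm.trans h6')
    have hy : c.2 = c'.2 := by rw [h3, h3', hx]
    exact Prod.ext rfl (Prod.ext hx hy)

end ParabolaDrawing

/-! ### The staircase -/

/-- The points of the staircase with `σ` alternating vertical and horizontal steps of length `D`,
starting at the origin. -/
def Stair (D σ u w : ℕ) : Prop :=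
  ∃ q r, r ≤ D ∧ ((2 * q < σ ∧ u = q * D ∧ w = q * D + r) ∨
    (2 * q + 1 < σ ∧ u = q * D + r ∧ w = q * D + D))

/-- Supplies the nonlinear facts about multiples of `D`, so that `omega` can treat the products as
atoms. -/
theorem mul_separated (D q q' : ℕ) :
    (q = q' ∧ q * D = q' * D) ∨ (q < q' ∧ q * D + D ≤ q' * D) ∨ (q' < q ∧ q' * D + D ≤ q * D) := by
  rcases lt_trichotomy q q' with h | h | h
  · exact Or.inr (Or.inl ⟨h, by nlinarith⟩)
  · exact Or.inl ⟨h, by rw [h]⟩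
  · exact Or.inr (Or.inr ⟨h, by nlinarith⟩)

namespace Stair

variable {D σ u w u' w' : ℕ}

theorem fst_le (h : Stair D σ u w) : u ≤ w := by
  obtain ⟨q, r, hr, h | h⟩ := h <;> omega

theorem snd_le (h : Stair D σ u w) : w ≤ u + D := by
  obtain ⟨q, r, hr, h | h⟩ := h <;> omega

theorem fst_le_mul (h : Stair D σ u w) : u ≤ σ / 2 * D := by
  obtain ⟨q, r, hr, h | h⟩ := h <;> rcases mul_separated D q (σ / 2) with h' | h' | h' <;> omega

theorem snd_le_mul (h : Stair D σ u w) : w ≤ (σ - σ / 2) * D := by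
  obtain ⟨q, r, hr, h | h⟩ := h <;>
    rcases mul_separated D q (σ - σ / 2) with h' | h' | h' <;> omega

/-- The staircase is a monotone path, so the coordinate sum orders its points in both coordinates at
once. -/
theorem mono (h : Stair D σ u w) (h' : Stair D σ u' w') (hle : u + w ≤ u' + w') :
    u ≤ u' ∧ w ≤ w' := by
  obtain ⟨q, r, hr, h⟩ := h
  obtain ⟨q', r', hr', h'⟩ := h'
  have := mul_separated D q q'
  rcases h with h | h <;> rcases h' with h' | h' <;> rcases this with h2 | h2 | h2 <;> omega

/-- Reflection in the line `u + w = m * D` exchanges vertical and horizontal steps; the number of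
steps must be even for this to preserve the staircase. -/
theorem reverse {m : ℕ} (h : Stair D (2 * m) u w) : Stair D (2 * m) (m * D - w) (m * D - u) := by
  obtain ⟨q, r, hr, h | h⟩ := h
  · obtain ⟨c, rfl⟩ : ∃ c, m = q + 1 + c := Nat.exists_eq_add_of_le (by omega)
    refine ⟨c, D - r, by omega, Or.inr ?_⟩
    have : (q + 1 + c) * D = q * D + D + c * D := by ring
    omega
  · obtain ⟨c, rfl⟩ : ∃ c, m = q + 1 + c := Nat.exists_eq_add_of_le (by omega)
    refine ⟨c, D - r, by omega, Or.inl ?_⟩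
    have : (q + 1 + c) * D = q * D + D + c * D := by ring
    omega

/-- For even `σ` the two points are mirror images under `reverse`, and equality holds. For odd `σ`
the bounds `w ≤ u + D` and `u' ≤ w'` suffice. -/
theorem snd_add_le (h : Stair D σ u w) (h' : Stair D σ u' w')
    (hs : u + w + u' + w' = σ * D) : σ / 2 * D ≤ u + w' := by
  obtain ⟨m, rfl | rfl⟩ := Nat.even_or_odd' σ
  · have e1 : 2 * m / 2 = m := by omega
    have e2 : 2 * m * D = 2 * (m * D) := by ring
    have a := h.fst_le_mul
    have b := h.snd_le_mul
    rw [e1] at a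
    rw [show 2 * m - 2 * m / 2 = m by omega] at b
    rw [e1]
    have c := h'.mono h.reverse (by omega)
    have d := h.reverse.mono h' (by omega)
    omega
  · have e1 : (2 * m + 1) / 2 = m := by omega
    have e2 : (2 * m + 1) * D = 2 * (m * D) + D := by ring
    rw [e1]
    have a := h.snd_le
    have b := h'.fst_le
    omega

end Stair

/-! ### Rotated chords: disjointness and crossings -/

/-- `x` and `y` are the ends of the chord belonging to the point `(u, w)` of the staircase after a
rotation by `i`, where the positions are `0, …, n - 1` with `n = σ * D + 2`. -/
structure RotatedChord (D σ i u w x y : ℕ) : Prop where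
  stair : Stair D σ u w
  fst_eq : x = u + i
  snd_lt : y < σ * D + 2
  snd_eq : y + w + 1 = i ∨ y + w + 1 = σ * D + 2 + i

namespace RotatedChord

variable {D σ h i i' u w u' w' x y x' y' : ℕ}

theorem half_mul_add (D σ : ℕ) : σ / 2 * D + (σ - σ / 2) * D = σ * D := by
  rw [← add_mul]; congr 1; omega

theorem half_mul_le (D σ : ℕ) : σ / 2 * D ≤ (σ - σ / 2) * D :=
  Nat.mul_le_mul_right _ (by omega)

/-- Passing from one rotation to another with the ends fixed would move `u` and `w` in opposite
directions, against monotonicity. -/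
theorem eq_of_same_ends (H : RotatedChord D σ i u w x y)
    (H' : RotatedChord D σ i' u' w' x y) : i = i' := by
  have a := H.stair.fst_le_mul
  have a' := H'.stair.fst_le_mul
  have b := H.stair.snd_le_mul
  have b' := H'.stair.snd_le_mul
  have e := half_mul_add D σ
  have e2 := half_mul_le D σ
  have c := H.stair.mono H'.stair
  have c' := H'.stair.mono H.stair
  obtain ⟨-, h1, h2, h3⟩ := H
  obtain ⟨-, h1', h2', h3'⟩ := H'
  omega

/-- Adding the two congruences modulo `n = σ * D + 2` gives `u + w + u' + w' = σ * D`. Moreover `i'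
- i` is congruent to `u + w' + 1`, and `i - i'` to `u' + w + 1`. These two numbers add up to `n`,
and by `Stair.snd_add_le` both are at least `h`, whereas `|i - i'| < h`. -/
theorem not_swapped_ends (hh : h ≤ σ / 2 * D + 1) (hi : i < h) (hi' : i' < h)
    (H : RotatedChord D σ i u w x y) (H' : RotatedChord D σ i' u' w' y x) : False := by
  have a := H.stair.fst_le_mul
  have a' := H'.stair.fst_le_mul
  have b := H.stair.snd_le_mul
  have b' := H'.stair.snd_le_mul
  have e := half_mul_add D σ
  have e2 := half_mul_le D σ
  have c := H.stair.snd_add_le H'.stair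
  have c' := H'.stair.snd_add_le H.stair
  obtain ⟨-, h1, h2, h3⟩ := H
  obtain ⟨-, h1', h2', h3'⟩ := H'
  omega

/-- Chords with interleaving ends belong to nearby points of the staircase. -/
theorem sum_le_of_interleaving (hi : i < h) (hi' : i' < h)
    (H : RotatedChord D σ i u w x y) (H' : RotatedChord D σ i' u' w' x' y')
    (hc : (min x y < min x' y' ∧ min x' y' < max x y ∧ max x y < max x' y') ∨
      (min x' y' < min x y ∧ min x y < max x' y' ∧ max x' y' < max x y)) :
    u' + w' ≤ u + w + (2 * h + D) ∧ u + w ≤ u' + w' + (2 * h + D) := by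
  have c := H.stair.mono H'.stair
  have c' := H'.stair.mono H.stair
  have d := H.stair.fst_le
  have d' := H'.stair.fst_le
  have e := H.stair.snd_le
  have e' := H'.stair.snd_le
  have a := H.stair.fst_le_mul
  have a' := H'.stair.fst_le_mul
  have b := H.stair.snd_le_mul
  have b' := H'.stair.snd_le_mul
  -- Unrotated chords are nested in the order of `u + w`. Rotations by less than `h` can make them
  -- interleave only if one coordinate differs by less than `h`; as `0 ≤ w - u ≤ D`, the other then
  -- differs by less than `h + D`.
  have f := half_mul_add D σ
  obtain ⟨-, h1, h2, h3⟩ := H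
  obtain ⟨-, h1', h2', h3'⟩ := H'
  rcases h3 with h3 | h3 <;> rcases h3' with h3' | h3'
  · have : min x y = y := by omega
    have : max x y = x := by omega
    have : min x' y' = y' := by omega
    have : max x' y' = x' := by omega
    rcases le_total (u + w) (u' + w') with h | h <;> rcases hc with hc | hc <;> omega
  · have : min x y = y := by omega
    have : max x y = x := by omega
    have : min x' y' = x' := by omega
    have : max x' y' = y' := by omega
    rcases le_total (u + w) (u' + w') with h | h <;> rcases hc with hc | hc <;> omega
  · have : min x y = x := by omega
    have : max x y = y := by omega
    have : min x' y' = y' := by omega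
    have : max x' y' = x' := by omega
    rcases le_total (u + w) (u' + w') with h | h <;> rcases hc with hc | hc <;> omega
  · have : min x y = x := by omega
    have : max x y = y := by omega
    have : min x' y' = x' := by omega
    have : max x' y' = y' := by omega
    rcases le_total (u + w) (u' + w') with h | h <;> rcases hc with hc | hc <;> omega

end RotatedChord

/-! ### Positions of the zigzag -/

section CaterpillarPositions

variable {D σ k k' r r' : ℕ}

/-- The position of the `k`-th spine vertex of a caterpillar drawn as a zigzag along the staircase;
positions are `0, …, σ * D + 1`. -/
def spinePosition (D σ k : ℕ) : ℕ :=
  if k % 2 = 0 then k / 2 * D else σ * D + 1 - (k / 2 * D + D)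

/-- The position of the `r`-th neighbour of the `k`-th spine vertex. -/
def neighborPosition (D σ k r : ℕ) : ℕ :=
  if k % 2 = 0 then σ * D + 1 - (k / 2 * D + r) else k / 2 * D + r

/-- Consecutive spine vertices own consecutive steps of the staircase, which share a corner: the
edge joining them. -/
theorem neighborPosition_top (D σ k : ℕ) : neighborPosition D σ k D = spinePosition D σ (k + 1) := by
  unfold neighborPosition spinePosition
  rcases Nat.even_or_odd' k with ⟨q, rfl | rfl⟩
  · rw [if_pos (by omega), if_neg (by omega), show (2 * q + 1) / 2 = 2 * q / 2 by omega]
  · rw [if_neg (by omega), if_pos (by omega), show (2 * q + 1 + 1) / 2 = (2 * q + 1) / 2 + 1 by omega,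
      add_mul, one_mul]

theorem stair_of_neighborPosition (hk : k < σ) (hr : r ≤ D) : ∃ u w, Stair D σ u w ∧
    ((spinePosition D σ k = u ∧ neighborPosition D σ k r + w + 1 = σ * D + 2) ∨
      (neighborPosition D σ k r = u ∧ spinePosition D σ k + w + 1 = σ * D + 2)) := by
  unfold neighborPosition spinePosition
  have e := RotatedChord.half_mul_add D σ
  by_cases h : k % 2 = 0
  · have hs : Stair D σ (k / 2 * D) (k / 2 * D + r) := ⟨k / 2, r, hr, by omega⟩
    have a := hs.fst_le_mul
    have b := hs.snd_le_mul
    exact ⟨_, _, hs, by rw [if_pos h, if_pos h]; omega⟩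
  · have hs : Stair D σ (k / 2 * D + r) (k / 2 * D + D) := ⟨k / 2, r, hr, by omega⟩
    have a := hs.fst_le_mul
    have b := hs.snd_le_mul
    exact ⟨_, _, hs, by rw [if_neg h, if_neg h]; omega⟩

theorem spinePosition_lt (hk : k < σ) : spinePosition D σ k < σ * D + 2 := by
  unfold spinePosition
  have h1 := mul_separated D (k / 2) σ
  split_ifs <;> omega

theorem neighborPosition_lt (hk : k < σ) (hr : r ≤ D) : neighborPosition D σ k r < σ * D + 2 := by
  unfold neighborPosition
  have h1 := mul_separated D (k / 2) σ
  split_ifs <;> omega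

theorem spinePosition_inj (hD : 0 < D) (hk : k < σ) (hk' : k' < σ)
    (h : spinePosition D σ k = spinePosition D σ k') : k = k' := by
  unfold spinePosition at h
  have h1 := mul_separated D (k / 2) (k' / 2)
  have h2 := mul_separated D (k / 2) (σ / 2)
  have h3 := mul_separated D (k' / 2) (σ / 2)
  have h4 := mul_separated D (k / 2) (σ - σ / 2)
  have h5 := mul_separated D (k' / 2) (σ - σ / 2)
  have e := RotatedChord.half_mul_add D σ
  split_ifs at h <;> omega

/-- Even spine vertices and neighbours of odd ones occupy positions up to `⌊σ/2⌋ * D`, all others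
lie above. The hypotheses on `r'` exclude the numbers reserved for the spine neighbours. -/
theorem spinePosition_ne_neighborPosition (hk : k < σ) (hk' : k' < σ) (hr' : r' ≤ D)
    (h0 : 0 < k' → r' ≠ 0) (h1 : k' + 1 < σ → r' ≠ D) :
    spinePosition D σ k ≠ neighborPosition D σ k' r' := by
  intro h
  unfold spinePosition neighborPosition at h
  have h1 := mul_separated D (k / 2) (k' / 2)
  have h1' := mul_separated D (k / 2) (k' / 2 + 1)
  have h1'' := mul_separated D (k / 2 + 1) (k' / 2)
  rw [add_mul, one_mul] at h1' h1''
  have h2 := mul_separated D (k / 2) (σ / 2)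
  have h3 := mul_separated D (k' / 2) (σ / 2)
  have h4 := mul_separated D (k / 2) (σ - σ / 2)
  have h5 := mul_separated D (k' / 2) (σ - σ / 2)
  have e := RotatedChord.half_mul_add D σ
  split_ifs at h <;> omega

theorem neighborPosition_inj (hk : k < σ) (hk' : k' < σ) (hr : r ≤ D) (hr' : r' ≤ D)
    (h0' : 0 < k' → r' ≠ 0) (h1' : k' + 1 < σ → r' ≠ D)
    (h : neighborPosition D σ k r = neighborPosition D σ k' r') : k = k' ∧ r = r' := by
  unfold neighborPosition at h
  have h1 := mul_separated D (k / 2) (k' / 2)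
  have h2 := mul_separated D (k / 2) (σ / 2)
  have h3 := mul_separated D (k' / 2) (σ / 2)
  have h4 := mul_separated D (k / 2) (σ - σ / 2)
  have h5 := mul_separated D (k' / 2) (σ - σ / 2)
  have e := RotatedChord.half_mul_add D σ
  split_ifs at h <;> omega

end CaterpillarPositions

/-! ### Structure of regular caterpillars and their zigzag drawing -/

section CaterpillarStructure

variable {V : Type*} [Fintype V] {C : SimpleGraph V} [DecidableRel C.Adj] {Δ : ℕ}

theorem mem_spine {v : V} : v ∈ spine C ↔ C.degree v ≠ 1 := by simp [spine]

theorem IsCaterpillar.exists_spine_index (hC : IsCaterpillar C) :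
    ∃ κ : V → ℕ, (∀ v ∈ spine C, κ v < (spine C).card) ∧
      (∀ v ∈ spine C, ∀ w ∈ spine C, κ v = κ w → v = w) ∧
      (∀ v ∈ spine C, ∀ w ∈ spine C, C.Adj v w ↔ κ v + 1 = κ w ∨ κ w + 1 = κ v) ∧
      ∀ k < (spine C).card, ∃ v ∈ spine C, κ v = k := by
  classical
  obtain ⟨e⟩ := hC.spine_path
  refine ⟨fun v => if hv : v ∈ spine C then (e ⟨v, hv⟩ : ℕ) else 0, ?_, ?_, ?_, ?_⟩
  · intro v hv
    simp only [hv, dif_pos]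
    exact (e ⟨v, hv⟩).2
  · intro v hv w hw h
    simp only [hv, hw, dif_pos] at h
    exact congrArg Subtype.val (e.injective (Fin.ext h))
  · intro v hv w hw
    simp only [hv, hw, dif_pos]
    rw [← SimpleGraph.pathGraph_adj, e.map_adj_iff]
    simp
  · intro k hk
    refine ⟨e.symm ⟨k, hk⟩, (e.symm ⟨k, hk⟩).2, ?_⟩
    have h : ((e.symm ⟨k, hk⟩ : (spine C : Set V)) : V) ∈ spine C := (e.symm ⟨k, hk⟩).2
    simp only [h, dif_pos]
    simp

/-- Handshake: `σ * D + n = 2 * (n - 1)`. -/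
theorem IsRegularCaterpillar.card_eq (hC : IsRegularCaterpillar C Δ) :
    Fintype.card V = (spine C).card * (Δ - 1) + 2 := by
  classical
  have h1 := C.sum_degrees_eq_twice_card_edges
  have h2 := hC.isTree.card_edgeFinset
  have h3 : ∀ v, C.degree v = (if v ∈ spine C then Δ - 1 else 0) + 1 := by
    intro v
    have := hC.two_le
    split_ifs with h
    · rw [hC.degree_eq v h]; omega
    · rw [mem_spine, not_not] at h; omega
  simp only [h3, Finset.sum_add_distrib, Finset.sum_const, Finset.sum_ite_mem, Finset.univ_inter,
    Finset.card_univ, smul_eq_mul, mul_one] at h1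
  omega

/-- Two adjacent leaves would form a whole component, missing the nonempty spine. -/
theorem IsRegularCaterpillar.mem_spine_or (hC : IsRegularCaterpillar C Δ) {x y : V}
    (hxy : C.Adj x y) : x ∈ spine C ∨ y ∈ spine C := by
  by_contra! h
  simp only [mem_spine, not_not, SimpleGraph.degree_eq_one_iff_existsUnique_adj] at h
  obtain ⟨s, hs⟩ := hC.spine_nonempty
  have hr : ∀ v, Relation.ReflTransGen C.Adj x v → v = x ∨ v = y := by
    intro v hv
    induction hv with
    | refl => exact Or.inl rfl
    | tail _ hbc ih =>
      rcases ih with rfl | rfl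
      · exact Or.inr (h.1.unique hbc hxy)
      · exact Or.inl (h.2.unique hbc hxy.symm)
  rw [mem_spine, ne_eq, SimpleGraph.degree_eq_one_iff_existsUnique_adj] at hs
  rcases hr s ((SimpleGraph.reachable_iff_reflTransGen _ _).1 (hC.isTree.connected x s)) with rfl | rfl
  · exact hs h.1
  · exact hs h.2

theorem IsRegularCaterpillar.exists_neighbor_index (hC : IsRegularCaterpillar C Δ) {κ : V → ℕ}
    (hinj : ∀ v ∈ spine C, ∀ w ∈ spine C, κ v = κ w → v = w)
    (hadj : ∀ v ∈ spine C, ∀ w ∈ spine C, C.Adj v w ↔ κ v + 1 = κ w ∨ κ w + 1 = κ v) {v : V}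
    (hv : v ∈ spine C) :
    ∃ ρ : V → ℕ, (∀ x, C.Adj v x → ρ x ≤ Δ - 1) ∧
      (∀ x y, C.Adj v x → C.Adj v y → ρ x = ρ y → x = y) ∧
      ∀ x ∈ spine C, C.Adj v x → ρ x = if κ x < κ v then 0 else Δ - 1 := by
  classical
  have h2 := hC.two_le
  have hcard : Fintype.card (C.neighborSet v) = (Finset.range Δ).card := by
    rw [SimpleGraph.card_neighborSet_eq_degree, hC.degree_eq v hv, Finset.card_range]
  -- The prescribed numbers `0` (previous spine vertex) and `Δ - 1` (next one) differ because `Δ ≥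
  -- 2`, so this partial injection extends to a bijection.
  obtain ⟨g, hg⟩ := Set.MapsTo.exists_equiv_extend_of_card_eq hcard
    (s := {x | (x : V) ∈ spine C}) (f := fun x => if κ x < κ v then 0 else Δ - 1)
    (by
      intro x _
      simp only [Finset.coe_range, Set.mem_Iio]
      split_ifs <;> omega)
    (by
      rintro ⟨x, hx⟩ hxs ⟨y, hy⟩ hys hxy
      have a := (hadj v hv x hxs).1 hx
      have b := (hadj v hv y hys).1 hy
      refine Subtype.ext (hinj x hxs y hys ?_)
      simp only at hxy
      split_ifs at hxy <;> omega)
  refine ⟨fun x => if hx : C.Adj v x then (g ⟨x, hx⟩ : ℕ) else 0, ?_, ?_, ?_⟩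
  · intro x hx
    simp only [hx, dif_pos]
    have := Finset.mem_range.1 (g ⟨x, hx⟩).2
    omega
  · intro x y hx hy h
    simp only [hx, hy, dif_pos] at h
    exact congrArg Subtype.val (g.injective (Subtype.ext h))
  · intro x hxs hx
    simp only [hx, dif_pos]
    exact hg ⟨x, hx⟩ hxs

/-- A regular caterpillar can be drawn as a zigzag along the staircase. -/
theorem IsRegularCaterpillar.exists_zigzag (hC : IsRegularCaterpillar C Δ) :
    ∃ g : V → ℕ, Function.Injective g ∧ (∀ v, g v < (spine C).card * (Δ - 1) + 2) ∧
      ∀ x y, C.Adj x y → ∃ u w, Stair (Δ - 1) (spine C).card u w ∧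
        ((g x = u ∧ g y + w + 1 = (spine C).card * (Δ - 1) + 2) ∨
          (g y = u ∧ g x + w + 1 = (spine C).card * (Δ - 1) + 2)) := by
  classical
  have hD : 0 < Δ - 1 := by have := hC.two_le; omega
  obtain ⟨κ, hlt, hinj, hadj, hsurj⟩ := hC.toIsCaterpillar.exists_spine_index
  choose! ρ hρle hρinj hρspine using
    fun v (hv : v ∈ spine C) => hC.exists_neighbor_index hinj hadj hv
  have hpar : ∀ x, x ∉ spine C → ∃ v ∈ spine C, C.Adj v x := by
    intro x hx
    have h := hx
    rw [mem_spine, not_not, SimpleGraph.degree_eq_one_iff_existsUnique_adj] at h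
    obtain ⟨v, hv, -⟩ := h
    exact ⟨v, (hC.mem_spine_or hv).resolve_left hx, hv.symm⟩
  choose! π hπs hπ using hpar
  have hπu : ∀ v x, x ∉ spine C → C.Adj v x → π x = v := by
    intro v x hx hv
    have h := hx
    rw [mem_spine, not_not, SimpleGraph.degree_eq_one_iff_existsUnique_adj] at h
    exact h.unique (hπ x hx).symm hv.symm
  -- The numbers `0` and `Δ - 1` go to leaves only at the ends of the spine; elsewhere a spine
  -- neighbour has them.
  have hzero : ∀ x, x ∉ spine C → 0 < κ (π x) → ρ (π x) x ≠ 0 := by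
    intro x hx h0 h
    obtain ⟨y, hy, hyκ⟩ := hsurj (κ (π x) - 1) (by have := hlt _ (hπs x hx); omega)
    have hxy := (hadj _ (hπs x hx) y hy).2 (by omega)
    have h1 := hρspine _ (hπs x hx) y hy hxy
    rw [if_pos (by omega)] at h1
    exact hx (hρinj _ (hπs x hx) x y (hπ x hx) hxy (h.trans h1.symm) ▸ hy)
  have htop : ∀ x, x ∉ spine C → κ (π x) + 1 < (spine C).card → ρ (π x) x ≠ Δ - 1 := by
    intro x hx h0 h
    obtain ⟨y, hy, hyκ⟩ := hsurj (κ (π x) + 1) h0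
    have hxy := (hadj _ (hπs x hx) y hy).2 (by omega)
    have h1 := hρspine _ (hπs x hx) y hy hxy
    rw [if_neg (by omega)] at h1
    exact hx (hρinj _ (hπs x hx) x y (hπ x hx) hxy (h.trans h1.symm) ▸ hy)
  set σ := (spine C).card
  let g : V → ℕ := fun x => if x ∈ spine C then spinePosition (Δ - 1) σ (κ x)
    else neighborPosition (Δ - 1) σ (κ (π x)) (ρ (π x) x)
  have gs : ∀ x ∈ spine C, g x = spinePosition (Δ - 1) σ (κ x) := fun x hx => if_pos hx
  have gl : ∀ x, x ∉ spine C → g x = neighborPosition (Δ - 1) σ (κ (π x)) (ρ (π x) x) :=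
    fun x hx => if_neg hx
  have hne : ∀ x ∈ spine C, ∀ y, y ∉ spine C → g x ≠ g y := by
    intro x hx y hy
    rw [gs x hx, gl y hy]
    exact spinePosition_ne_neighborPosition (hlt x hx) (hlt _ (hπs y hy))
      (hρle _ (hπs y hy) y (hπ y hy)) (hzero y hy) (htop y hy)
  -- Each edge is read from its spine end of smaller index, so a spine vertex at the other end has
  -- number `Δ - 1`.
  have hedge : ∀ x ∈ spine C, ∀ y, C.Adj x y → (y ∈ spine C → κ x < κ y) →
      ∃ u w, Stair (Δ - 1) σ u w ∧
        ((g x = u ∧ g y + w + 1 = σ * (Δ - 1) + 2) ∨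
          (g y = u ∧ g x + w + 1 = σ * (Δ - 1) + 2)) := by
    intro x hx y hxy hlt'
    have h := stair_of_neighborPosition (hlt x hx) (hρle x hx y hxy)
    rw [gs x hx]
    by_cases hy : y ∈ spine C
    · have h1 := hρspine x hx y hy hxy
      rw [if_neg (by have := hlt' hy; omega)] at h1
      rw [h1, neighborPosition_top] at h
      have h2 := (hadj x hx y hy).1 hxy
      rwa [gs y hy, show κ y = κ x + 1 by have := hlt' hy; omega]
    · rwa [gl y hy, hπu x y hy hxy]
  refine ⟨g, ?_, ?_, ?_⟩
  · intro x y h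
    by_cases hx : x ∈ spine C <;> by_cases hy : y ∈ spine C
    · rw [gs x hx, gs y hy] at h
      exact hinj x hx y hy (spinePosition_inj hD (hlt x hx) (hlt y hy) h)
    · exact absurd h (hne x hx y hy)
    · exact absurd h.symm (hne y hy x hx)
    · rw [gl x hx, gl y hy] at h
      obtain ⟨h1, h2⟩ := neighborPosition_inj (hlt _ (hπs x hx)) (hlt _ (hπs y hy))
        (hρle _ (hπs x hx) x (hπ x hx)) (hρle _ (hπs y hy) y (hπ y hy))
        (hzero y hy) (htop y hy) h
      have h3 := hinj _ (hπs x hx) _ (hπs y hy) h1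
      rw [← h3] at h2
      exact hρinj _ (hπs x hx) x y (hπ x hx) (h3 ▸ hπ y hy) h2
  · intro x
    by_cases hx : x ∈ spine C
    · rw [gs x hx]; exact spinePosition_lt (hlt x hx)
    · rw [gl x hx]
      exact neighborPosition_lt (hlt _ (hπs x hx)) (hρle _ (hπs x hx) x (hπ x hx))
  · intro x y hxy
    have hswap : ∀ a b, C.Adj a b → a ∈ spine C → (b ∈ spine C → κ a < κ b) →
        (a = x ∧ b = y ∨ a = y ∧ b = x) → ∃ u w, Stair (Δ - 1) σ u w ∧
        ((g x = u ∧ g y + w + 1 = σ * (Δ - 1) + 2) ∨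
          (g y = u ∧ g x + w + 1 = σ * (Δ - 1) + 2)) := by
      rintro a b hab ha hb (⟨rfl, rfl⟩ | ⟨rfl, rfl⟩)
      · exact hedge a ha b hab hb
      · obtain ⟨u, w, h1, h2⟩ := hedge a ha b hab hb
        exact ⟨u, w, h1, h2.symm⟩
    by_cases hx : x ∈ spine C
    · by_cases hy : y ∈ spine C ∧ κ y < κ x
      · exact hswap y x hxy.symm hy.1 (fun _ => hy.2) (Or.inr ⟨rfl, rfl⟩)
      · refine hswap x y hxy hx (fun h => ?_) (Or.inl ⟨rfl, rfl⟩)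
        have := (hadj x hx y h).1 hxy
        have : ¬ κ y < κ x := fun h' => hy ⟨h, h'⟩
        omega
    · exact hswap y x hxy.symm ((hC.mem_spine_or hxy).resolve_left hx) (fun h => absurd h hx)
        (Or.inr ⟨rfl, rfl⟩)

end CaterpillarStructure

/-! ### Necessity: degree counting -/

section Necessity

variable {V : Type*} [Fintype V] {C : SimpleGraph V} [DecidableRel C.Adj] {Δ h : ℕ}

/-- In an `h`-placement, the degrees of a vertex in the `h` copies add up to at most `n - 1`. -/
theorem IsPlacement.exists_spine_count (hC : IsRegularCaterpillar C Δ) {G : SimpleGraph V}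
    (hG : IsPlacement C h G) :
    ∃ a : V → ℕ, (∀ v, h + (Δ - 1) * a v + 1 ≤ Fintype.card V) ∧
      ∑ v, a v = h * (spine C).card := by
  classical
  obtain ⟨T, -, hiso, hdisj⟩ := hG
  have hdeg : ∀ i v, (T i).degree v = (Δ - 1) * (if (T i).degree v ≠ 1 then 1 else 0) + 1 := by
    intro i v
    obtain ⟨e⟩ := hiso i
    have h1 : (T i).degree v = C.degree (e.symm v) := (e.symm.degree_eq v).symm
    rw [h1]
    have := hC.two_le
    split_ifs with h
    · rw [hC.degree_eq _ (mem_spine.2 h)]; omega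
    · omega
  refine ⟨fun v => ∑ i, if (T i).degree v ≠ 1 then 1 else 0, fun v => ?_, ?_⟩
  · have h1 : ∑ i, (T i).degree v = h + (Δ - 1) * ∑ i, if (T i).degree v ≠ 1 then 1 else 0 := by
      rw [Finset.sum_congr rfl fun i _ => hdeg i v, Finset.sum_add_distrib, Finset.mul_sum, add_comm]
      simp
    -- Edge-disjoint copies give `v` disjoint neighbourhoods, none containing `v`.
    have h2 : ∑ i, (T i).degree v = (Finset.univ.biUnion fun i => (T i).neighborFinset v).card := by
      rw [Finset.card_biUnion]
      · simp
      · intro i _ j _ hij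
        rw [Function.onFun, Finset.disjoint_left]
        intro x hx hx'
        rw [SimpleGraph.mem_neighborFinset] at hx hx'
        exact (Set.disjoint_left.1 (hdisj i j hij) : ∀ ⦃e⦄, _) (show s(v, x) ∈ _ from hx) hx'
    have h3 : (Finset.univ.biUnion fun i => (T i).neighborFinset v).card < Fintype.card V := by
      refine Finset.card_lt_univ_of_notMem (x := v) ?_
      simp
    show h + (Δ - 1) * (∑ i, if (T i).degree v ≠ 1 then 1 else 0) + 1 ≤ _
    omega
  · rw [Finset.sum_comm]
    have h1 : ∀ i, (∑ v, if (T i).degree v ≠ 1 then 1 else 0) = (spine C).card := by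
      intro i
      obtain ⟨e⟩ := hiso i
      rw [← Equiv.sum_comp e.toEquiv, spine, Finset.card_filter]
      refine Finset.sum_congr rfl fun v _ => ?_
      have : (T i).degree (e v) = C.degree v := e.degree_eq v
      simp only [RelIso.coe_fn_toEquiv, this]
    rw [Finset.sum_congr rfl fun i _ => h1 i]
    simp

theorem IsPlacement.le_half_spine (hC : IsRegularCaterpillar C Δ) {G : SimpleGraph V}
    (hG : IsPlacement C h G) : h ≤ (spine C).card / 2 * (Δ - 1) + 1 := by
  obtain ⟨a, ha, hsum⟩ := hG.exists_spine_count hC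
  have hcard := hC.card_eq
  by_contra! hlt
  set D := Δ - 1
  have hD : 0 < D := by have := hC.two_le; omega
  set n := Fintype.card V
  obtain ⟨m, hm | hm⟩ := Nat.even_or_odd' (spine C).card
  · rw [hm] at hcard hsum hlt
    rw [show 2 * m / 2 = m by omega] at hlt
    -- Since `D * σ = n - 2`, the sum yields `2 * h * (n - 1) ≤ n * (n - 1)`, that is `h ≤ n / 2 = m
    -- * D + 1`.
    have h1 : ∑ v : V, (h + D * a v + 1) ≤ ∑ _v : V, n := Finset.sum_le_sum fun v _ => ha v
    simp only [Finset.sum_add_distrib, ← Finset.mul_sum, hsum, Finset.sum_const, Finset.card_univ,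
      smul_eq_mul, mul_one] at h1
    change n * h + _ + n ≤ n * n at h1
    rw [hcard] at h1
    obtain ⟨c, rfl⟩ : ∃ c, h = m * D + 2 + c := Nat.exists_eq_add_of_le (by omega)
    nlinarith [Nat.zero_le (m * D), Nat.zero_le (m * D * c)]
  · rw [hm] at hcard hsum hlt
    rw [show (2 * m + 1) / 2 = m by omega] at hlt
    -- From `h ≥ m * D + 2` follows `D * a v ≤ n - 1 - h < (m + 1) * D`. Summing then gives `h * (2
    -- * m + 1) ≤ n * m`, so `h < m * D + 1`.
    have h1 : ∀ v, a v ≤ m := by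
      intro v
      by_contra! hv
      have h2 := Nat.mul_le_mul_left D (Nat.succ_le_of_lt hv)
      have h3 := ha v
      rw [hcard] at h3
      have e1 : (2 * m + 1) * D = 2 * (m * D) + D := by ring
      have e2 : D * m.succ = m * D + D := by rw [Nat.succ_eq_add_one]; ring
      omega
    have h4 : ∑ v : V, a v ≤ ∑ _v : V, m := Finset.sum_le_sum fun v _ => h1 v
    simp only [hsum, Finset.sum_const, Finset.card_univ, smul_eq_mul] at h4
    change _ ≤ n * m at h4
    rw [hcard] at h4
    obtain ⟨c, rfl⟩ : ∃ c, h = m * D + 2 + c := Nat.exists_eq_add_of_le (by omega)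
    nlinarith [Nat.zero_le (m * c)]

end Necessity

/-! ### Sufficiency: rotated zigzags -/

section Sufficiency

variable {V : Type*} [Fintype V] {C : SimpleGraph V} [DecidableRel C.Adj] {Δ h : ℕ}

theorem exists_rotation {n : ℕ} (p : V → ℕ) (hp : Function.Injective p)
    (hlt : ∀ v, p v < n) (hn : Fintype.card V = n) (i : ℕ) :
    ∃ φ : V ≃ V, ∀ v, p (φ v) = (p v + i) % n := by
  have hb : Function.Bijective (fun v => (⟨p v, hlt v⟩ : Fin n)) := by
    rw [Fintype.bijective_iff_injective_and_card]
    exact ⟨fun v w hvw => hp (congrArg Fin.val hvw), by simpa using hn⟩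
  have hrot : ∀ v, ∃ w, p w = (p v + i) % n := by
    intro v
    obtain ⟨w, hw⟩ := hb.2 ⟨(p v + i) % n, Nat.mod_lt _ (by have := hlt v; omega)⟩
    exact ⟨w, congrArg Fin.val hw⟩
  choose φ hφ using hrot
  have hinj : Function.Injective φ := by
    intro v w hvw
    have h1 : (p v + i) % n = (p w + i) % n := by rw [← hφ, ← hφ, hvw]
    have h2 : p v ≡ p w [MOD n] := Nat.ModEq.add_right_cancel' i h1
    exact hp (Nat.ModEq.eq_of_lt_of_lt h2 (hlt v) (hlt w))
  exact ⟨Equiv.ofBijective φ (Finite.injective_iff_bijective.1 hinj), hφ⟩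

/-- The copies of a regular caterpillar obtained by rotating its zigzag drawing. -/
theorem IsRegularCaterpillar.exists_rotated_copies (hC : IsRegularCaterpillar C Δ)
    (hh : h ≤ (spine C).card / 2 * (Δ - 1) + 1) :
    ∃ (p : V → ℕ) (T : Fin h → SimpleGraph V), Function.Injective p ∧
      (∀ i, Nonempty (C ≃g T i)) ∧ ∀ i x y, (T i).Adj x y → ∃ u w,
        RotatedChord (Δ - 1) (spine C).card i u w (p x) (p y) ∨
          RotatedChord (Δ - 1) (spine C).card i u w (p y) (p x) := by
  obtain ⟨p, hp, hlt, hedge⟩ := hC.exists_zigzag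
  choose φ hφ using fun i => exists_rotation p hp hlt hC.card_eq i
  refine ⟨p, fun i => C.map (φ i), hp, fun i => ⟨SimpleGraph.Iso.map (φ i) C⟩, ?_⟩
  have key : ∀ (i : Fin h) x y u w, Stair (Δ - 1) (spine C).card u w → p x = u →
      p y + w + 1 = (spine C).card * (Δ - 1) + 2 →
      RotatedChord (Δ - 1) (spine C).card i u w (p (φ i x)) (p (φ i y)) := by
    intro i x y u w hs hx hy
    have a := hs.fst_le_mul
    have b := hs.snd_le_mul
    have e := RotatedChord.half_mul_add (Δ - 1) (spine C).card
    have e2 := RotatedChord.half_mul_le (Δ - 1) (spine C).card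
    have hi := i.2
    refine ⟨hs, ?_, hlt _, ?_⟩
    -- No wrap-around at this end: both `u` and `i` are at most `⌊σ/2⌋ * D`.
    · rw [hφ, Nat.mod_eq_of_lt (by omega), hx]
    · rw [hφ]
      rcases lt_or_ge (p y + i) ((spine C).card * (Δ - 1) + 2) with h | h
      · rw [Nat.mod_eq_of_lt h]; omega
      · rw [Nat.mod_eq_sub_mod h, Nat.mod_eq_of_lt (by omega)]; omega
  rintro i _ _ ⟨-, x, y, hxy, rfl, rfl⟩
  obtain ⟨u, w, hs, ⟨h1, h2⟩ | ⟨h1, h2⟩⟩ := hedge x y hxy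
  · exact ⟨u, w, Or.inl (key i x y u w hs h1 h2)⟩
  · exact ⟨u, w, Or.inr (key i y x u w hs h1 h2)⟩

/-- Makes the pair (copy, coordinate sum) an injective label of chords, by which crossings are
counted. -/
theorem RotatedChord.eq_of_eq {D σ i u w u' w' x y x' y' : ℕ} (H : RotatedChord D σ i u w x y)
    (H' : RotatedChord D σ i u' w' x' y') (hs : u + w = u' + w') : x = x' ∧ y = y' := by
  have c := H.stair.mono H'.stair hs.le
  have c' := H'.stair.mono H.stair hs.ge
  obtain ⟨-, h1, h2, h3⟩ := H
  obtain ⟨-, h1', h2', h3'⟩ := H'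
  omega

/-- An `h`-placement of a regular caterpillar by rotated zigzags, with few crossings per edge. -/
theorem IsRegularCaterpillar.exists_kPlanar_placement (hC : IsRegularCaterpillar C Δ)
    (hh : h ≤ (spine C).card / 2 * (Δ - 1) + 1) :
    ∃ G : SimpleGraph V, IsPlacement C h G ∧ IsKPlanar G (h * (4 * h + 2 * Δ)) := by
  classical
  have h2 := hC.two_le
  obtain ⟨p, T, hp, hiso, hT⟩ := hC.exists_rotated_copies hh
  refine ⟨⨆ i, T i, ⟨T, fun i => le_iSup T i, hiso, ?_⟩, ?_⟩
  · intro i j hij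
    rw [Set.disjoint_left]
    intro e he he'
    induction e with
    | h x y =>
      rw [SimpleGraph.mem_edgeSet] at he he'
      refine hij (Fin.ext ?_)
      obtain ⟨u, w, H | H⟩ := hT i x y he <;> obtain ⟨u', w', H' | H'⟩ := hT j x y he'
      · exact H.eq_of_same_ends H'
      · exact (H.not_swapped_ends hh i.2 j.2 H').elim
      · exact (H.not_swapped_ends hh i.2 j.2 H').elim
      · exact H.eq_of_same_ends H'
  · have hG : ∀ x y, (⨆ i, T i).Adj x y → ∃ i, i < h ∧ ∃ a b u w, s(a, b) = s(x, y) ∧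
        RotatedChord (Δ - 1) (spine C).card i u w (p a) (p b) := by
      intro x y hxy
      obtain ⟨i, hi⟩ := SimpleGraph.iSup_adj.1 hxy
      obtain ⟨u, w, H | H⟩ := hT i x y hi
      · exact ⟨i, i.2, x, y, u, w, rfl, H⟩
      · exact ⟨i, i.2, y, x, u, w, Sym2.eq_swap, H⟩
    refine isKPlanar_of_interleaving hp fun x y hxy hlt => ?_
    obtain ⟨i, hi, a, b, u, w, hab, H⟩ := hG x y hxy
    have hf : ∀ f ∈ {f : Sym2 V | f ∈ (⨆ i, T i).edgeSet ∧ ∃ z t, f = s(z, t) ∧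
        ((p x < p z ∧ p z < p y ∧ p y < p t) ∨ (p z < p x ∧ p x < p t ∧ p t < p y))},
        ∃ i' s, i' < h ∧ (s ≤ u + w + (2 * h + (Δ - 1)) ∧ u + w ≤ s + (2 * h + (Δ - 1))) ∧
          ∃ a' b' u' w', f = s(a', b') ∧ u' + w' = s ∧
            RotatedChord (Δ - 1) (spine C).card i' u' w' (p a') (p b') := by
      rintro _ ⟨hfG, z, t, rfl, hc⟩
      obtain ⟨i', hi', a', b', u', w', hab', H'⟩ := hG z t hfG
      refine ⟨i', u' + w', hi', H.sum_le_of_interleaving hi hi' H' ?_, a', b', u', w', hab'.symm,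
        rfl, H'⟩
      rcases Sym2.eq_iff.1 hab with ⟨rfl, rfl⟩ | ⟨rfl, rfl⟩ <;>
        rcases Sym2.eq_iff.1 hab' with ⟨rfl, rfl⟩ | ⟨rfl, rfl⟩ <;> omega
    choose! I S hI hS ha using hf
    -- Each copy contributes at most `2 * (2 * h + D) + 1 = 4 * h + 2 * Δ - 1` sums.
    have hcard : (Finset.range h ×ˢ Finset.Icc (u + w - (2 * h + (Δ - 1)))
        (u + w + (2 * h + (Δ - 1)))).card ≤ h * (4 * h + 2 * Δ) := by
      rw [Finset.card_product, Finset.card_range, Nat.card_Icc]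
      exact Nat.mul_le_mul_left _ (by omega)
    refine le_trans ?_ (Nat.cast_le.2 hcard)
    rw [← Set.encard_coe_eq_coe_finsetCard]
    refine Set.encard_le_encard_of_injOn (f := fun f => (I f, S f)) ?_ ?_
    · intro f hf
      have h1 := hI f hf
      have h3 := hS f hf
      simp only [Finset.coe_product, Set.mem_prod, Finset.mem_coe, Finset.mem_range, Finset.mem_Icc]
      omega
    · intro f hf f' hf' hff
      obtain ⟨e1, e2⟩ := Prod.mk.inj hff
      obtain ⟨a₁, b₁, u₁, w₁, hfe, hs, H₁⟩ := ha f hf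
      obtain ⟨a₂, b₂, u₂, w₂, hfe', hs', H₂⟩ := ha f' hf'
      rw [e1] at H₁
      obtain ⟨h3, h4⟩ := H₁.eq_of_eq H₂ (by omega)
      rw [hfe, hfe', hp h3, hp h4]

end Sufficiency

/-! ### The numerical conditions and the conclusion -/

/-- By `n = σ * D + 2`, (ii) reads `2 * h ≤ 2 * ⌊σ/2⌋ * D + 2` for either parity; (i) then follows
because `σ ≥ 1`. -/
theorem IsRegularCaterpillar.placement_conditions_iff {V : Type*} [Fintype V] {C : SimpleGraph V}
    [DecidableRel C.Adj] {Δ h : ℕ} (hC : IsRegularCaterpillar C Δ) :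
    ((Δ : ℤ) ≤ (Fintype.card V : ℤ) - h ∧
      (Fintype.card V : ℤ) ≥ 2 * h + ((Δ : ℤ) - 1) * (((spine C).card % 2 : ℕ) : ℤ)) ↔
    h ≤ (spine C).card / 2 * (Δ - 1) + 1 := by
  have hpos := Finset.card_pos.2 hC.spine_nonempty
  obtain ⟨D, rfl⟩ : ∃ D, Δ = D + 1 := ⟨Δ - 1, by have := hC.two_le; omega⟩
  rw [hC.card_eq]
  generalize (spine C).card = σ at *
  rw [show D + 1 - 1 = D from rfl]
  obtain ⟨m, rfl | rfl⟩ := Nat.even_or_odd' σ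
  · rw [show 2 * m / 2 = m by omega, show 2 * m % 2 = 0 by omega]
    have e : 2 * m * D = 2 * (m * D) := by ring
    have : D ≤ m * D := Nat.le_mul_of_pos_left _ (by omega)
    rw [e]
    push_cast
    generalize hM : m * D = M at *
    have : (m : ℤ) * D = M := by rw [← hM]; push_cast; rfl
    rw [this]
    omega
  · rw [show (2 * m + 1) / 2 = m by omega, show (2 * m + 1) % 2 = 1 by omega]
    have e : (2 * m + 1) * D = 2 * (m * D) + D := by ring
    rw [e]
    push_cast
    generalize hM : m * D = M at *
    have : (m : ℤ) * D = M := by rw [← hM]; push_cast; rfl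
    rw [this]
    omega

theorem theorem2 :
    ∃ K : ℕ, ∀ (V : Type*) [Fintype V] (C : SimpleGraph V) [DecidableRel C.Adj] (Δ h : ℕ),
      IsRegularCaterpillar C Δ →
        ((∃ G : SimpleGraph V, IsPlacement C h G) ↔
          (Δ : ℤ) ≤ (Fintype.card V : ℤ) - h ∧
            (Fintype.card V : ℤ) ≥ 2 * h + ((Δ : ℤ) - 1) * (((spine C).card % 2 : ℕ) : ℤ)) ∧
        ((∃ G : SimpleGraph V, IsPlacement C h G) →
          ∃ (G : SimpleGraph V) (k : ℕ),
            IsPlacement C h G ∧ IsKPlanar G k ∧ k ≤ K * (Δ * h + h ^ 2)) := by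
  -- `K = 4` covers `h * (4 * h + 2 * Δ)`.
  refine ⟨4, fun V _ C _ Δ h hC => ⟨?_, ?_⟩⟩
  · rw [hC.placement_conditions_iff]
    exact ⟨fun ⟨G, hG⟩ => hG.le_half_spine hC,
      fun hh => (hC.exists_kPlanar_placement hh).imp fun G hG => hG.1⟩
  · rintro ⟨G, hG⟩
    obtain ⟨G', hG', hk⟩ := hC.exists_kPlanar_placement (hG.le_half_spine hC)
    exact ⟨G', _, hG', hk, by nlinarith [Nat.zero_le (Δ * h)]⟩
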